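/- Let $k\ge 0$, let $p_1,\dots,p_k$ be distinct prime numbers, let $f_1,\dots,f_k:\mathbb{R}\to\mathbb{R}$ be functions with $f_i(x)>0$ for every $x>0$, and let $\psi:\mathbb{N}\to\mathbb{R}$ be a non-negative (weakly) decreasing function, where $\mathbb{N}=\{1,2,3,\dots\}$. Write $|n|_p$ for the usual $p$-adic norm of $n$ and $\|x\|$ for the distance from the real number $x$ to the nearest integer. (i) If $\displaystyle\sum_{n\in\mathbb{N}}\frac{\psi(n)}{f_1(|n|_{p_1})\cdots f_k(|n|_{p_k})}$ diverges, then for Lebesgue-almost every real number $\alpha$ the inequality $$f_1(|n|_{p_1})\cdots f_k(|n|_{p_k})\,\|n\alpha\|\le\psi(n)$$ has infinitely many solutions $n\in\mathbb{N}$. (ii) If this sum converges, then for Lebesgue-almost every real number $\alpha$ the inequality has only finitely many solutions $n\in\mathbb{N}$. -/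

import Mathlib

open MeasureTheory

/-- The distance `‖x‖` from a real number `x` to the nearest integer. -/
noncomputable def distNearestInt (x : ℝ) : ℝ := |x - (round x : ℤ)|

/-- The product `f₁(|n|_{p₁}) ⋯ f_k(|n|_{p_k})` for a positive integer `n`. -/
noncomputable def padicWeight {k : ℕ} (p : Fin k → ℕ) (f : Fin k → ℝ → ℝ) (n : ℕ+) : ℝ :=
  ∏ i : Fin k, f i ((padicNorm (p i) ((n : ℕ) : ℚ) : ℚ) : ℝ)

/-!
Write `V n` for `ψ n / padicWeight p f n`. The inequality says that `α`, as a point of the circle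
`ℝ / ℤ`, satisfies `‖n • α‖ ≤ V n`, a condition of measure at most `2 * V n`
(`volume_norm_nsmul_le`), so the convergence half is the Borel–Cantelli lemma.

For divergence, if `V n > 1 / 2` infinitely often there is nothing to prove. Otherwise the result is
an instance of the Duffin–Schaeffer theorem (`ae_mem_addWellApproximable`): only the reduced
fractions `a / n` are used, and the neighbourhoods of radius `V n / n` around them are
quasi-independent (`volume_real_inter_approxAddOrderOf_le`), since distinct reduced fractions with
denominators `m` and `n` differ by a nonzero multiple of `gcd m n / (m n)`. The Chung–Erdős
inequality (`sq_sum_measureReal_le`) then gives a limsup set of positive measure, and Gallagher's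
zero-one law promotes this to full measure.

The second moment argument needs the partial sums of `φ(n) / n * V n` to dominate those of `V n`,
which is `totientRatio_mul_sum_le`. The integers are grouped by their valuations at the primes
`p i`; the weight is constant on each group and `ψ` is decreasing, so by Abel summation it suffices
that `φ(n) / n` has average bounded below on each group, uniformly in the group. A group with
valuations `v` contains the progression `q (1 + P t)`, with `q` the product of the `p i ^ v i` and
`P` the product of the `p i`, and there the bound follows from
`φ(n) / n ≥ exp (-2 ∑_{r ∣ n} 1 / r)` and the convexity of the exponential.
-/

/-! ### The average of `φ(n) / n` along a fibre of the valuations -/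

/-- The sum of `1 / p` over the prime divisors `p` of `n`. -/
noncomputable def invPrimeSum (n : ℕ) : ℝ := ∑ p ∈ n.primeFactors, (p : ℝ)⁻¹

lemma exp_neg_two_mul_le {x : ℝ} (hx0 : 0 ≤ x) (hx : x ≤ 1 / 2) :
    Real.exp (-(2 * x)) ≤ 1 - x := by
  rw [Real.exp_neg, inv_le_comm₀ (Real.exp_pos _) (by linarith)]
  refine le_trans ?_ (Real.add_one_le_exp (2 * x))
  rw [inv_le_iff_one_le_mul₀ (by linarith)]
  nlinarith

lemma exp_neg_invPrimeSum_le_totient_div {n : ℕ} (hn : n ≠ 0) :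
    Real.exp (-(2 * invPrimeSum n)) ≤ (n.totient : ℝ) / n := by
  have h : (n.totient : ℝ) = n * ∏ p ∈ n.primeFactors, (1 - (p : ℝ)⁻¹) := by
    have := congrArg (Rat.cast : ℚ → ℝ) (Nat.totient_eq_mul_prod_factors n)
    push_cast at this
    exact this
  rw [h, mul_div_cancel_left₀ _ (by exact_mod_cast hn), invPrimeSum, Finset.mul_sum,
    ← Finset.sum_neg_distrib, Real.exp_sum]
  refine Finset.prod_le_prod (fun _ _ => (Real.exp_pos _).le) fun p hp => ?_
  have h2 : (2 : ℝ) ≤ p := by exact_mod_cast (Nat.prime_of_mem_primeFactors hp).two_le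
  refine exp_neg_two_mul_le (by positivity) ?_
  rw [one_div]
  exact inv_anti₀ (by norm_num) h2

lemma invPrimeSum_mul_le {a b : ℕ} (ha : a ≠ 0) (hb : b ≠ 0) :
    invPrimeSum (a * b) ≤ invPrimeSum a + invPrimeSum b := by
  unfold invPrimeSum
  rw [Nat.primeFactors_mul ha hb, ← Finset.sum_union_inter]
  exact le_add_of_nonneg_right (Finset.sum_nonneg fun _ _ => by positivity)

lemma sum_invPrimeSum_le (M : ℕ) : ∑ m ∈ Finset.Ioc 0 M, invPrimeSum m ≤ M := by
  have h1 : ∀ m ∈ Finset.Ioc 0 M, invPrimeSum m ≤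
      ∑ p ∈ Finset.Ioc 1 M, if p ∣ m then (p : ℝ)⁻¹ else 0 := by
    intro m hm
    rw [Finset.mem_Ioc] at hm
    rw [← Finset.sum_filter]
    refine Finset.sum_le_sum_of_subset_of_nonneg (fun p hp => ?_) fun _ _ _ => by positivity
    have hp' := Nat.mem_primeFactors.1 hp
    simp only [Finset.mem_filter, Finset.mem_Ioc]
    exact ⟨⟨hp'.1.one_lt, (Nat.le_of_dvd hm.1 hp'.2.1).trans hm.2⟩, hp'.2.1⟩
  refine (Finset.sum_le_sum h1).trans ?_
  rw [Finset.sum_comm]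
  have h2 : ∀ p ∈ Finset.Ioc 1 M, (∑ m ∈ Finset.Ioc 0 M, if p ∣ m then (p : ℝ)⁻¹ else 0) ≤
      M * ((p : ℝ) ^ 2)⁻¹ := by
    intro p _
    rw [← Finset.sum_filter, Finset.sum_const, Nat.Ioc_filter_dvd_card_eq_div, nsmul_eq_mul]
    calc ((M / p : ℕ) : ℝ) * (p : ℝ)⁻¹ ≤ (M / p : ℝ) * (p : ℝ)⁻¹ := by
          gcongr
          exact Nat.cast_div_le
      _ = M * ((p : ℝ) ^ 2)⁻¹ := by rw [sq, mul_inv, div_eq_mul_inv, mul_assoc]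
  refine (Finset.sum_le_sum h2).trans ?_
  rw [← Finset.mul_sum]
  refine mul_le_of_le_one_right (by positivity) ?_
  rcases Nat.lt_or_ge M 1 with hM | hM
  · rw [Finset.Ioc_eq_empty (by omega)]
    simp
  · refine (sum_Ioc_inv_sq_le_sub one_ne_zero hM).trans ?_
    simp

/-- The average of `φ(n) / n` over `n = q (1 + P t)` with `n ≤ q M` is bounded below in terms of
`P` and the prime divisors of `q` only. -/
lemma le_sum_totient_div_progression {q P M : ℕ} (hq : q ≠ 0) (hP : P ≠ 0) (hM : M ≠ 0) {K : ℝ}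
    (hK : invPrimeSum q ≤ K) :
    Real.exp (-(2 * K + 2 * P)) / P * M ≤
      ∑ t ∈ Finset.range ((M - 1) / P + 1),
        ((q * (1 + P * t)).totient : ℝ) / (q * (1 + P * t) : ℕ) := by
  set T := (M - 1) / P + 1 with hT
  have hPpos : (0 : ℝ) < P := by positivity
  have hTM : (M : ℝ) ≤ P * T := by
    have h1 := Nat.lt_div_mul_add (a := M - 1) (b := P) (Nat.pos_of_ne_zero hP)
    have h2 : M ≤ P * T := by rw [hT, mul_add, mul_comm P]; omega
    exact_mod_cast h2
  have hsum : ∑ t ∈ Finset.range T, invPrimeSum (1 + P * t) ≤ M := by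
    have hinj : Set.InjOn (fun t => 1 + P * t) (Finset.range T : Set ℕ) := by
      intro a _ b _ hab
      have : P * a = P * b := by simpa using hab
      exact Nat.eq_of_mul_eq_mul_left (Nat.pos_of_ne_zero hP) this
    rw [← Finset.sum_image (f := invPrimeSum) hinj]
    refine (Finset.sum_le_sum_of_subset_of_nonneg ?_ fun _ _ _ =>
      Finset.sum_nonneg fun _ _ => by positivity).trans (sum_invPrimeSum_le M)
    intro m hm
    obtain ⟨t, ht, rfl⟩ := Finset.mem_image.1 hm
    have ht' : t ≤ (M - 1) / P := by have := Finset.mem_range.1 ht; omega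
    have := (Nat.mul_le_mul_left P ht').trans (Nat.mul_div_le (M - 1) P)
    simp only [Finset.mem_Ioc]
    omega
  -- The tangent line of the exponential at `-2 P` bounds `exp` from below by a linear function,
  -- whose average over the progression is controlled by `sum_invPrimeSum_le`.
  have hterm : ∀ t ∈ Finset.range T,
      Real.exp (-(2 * K + 2 * P)) * (1 + 2 * P - 2 * invPrimeSum (1 + P * t)) ≤
        ((q * (1 + P * t)).totient : ℝ) / (q * (1 + P * t) : ℕ) := by
    intro t _
    have hne : 1 + P * t ≠ 0 := by omega
    refine le_trans ?_ (exp_neg_invPrimeSum_le_totient_div (mul_ne_zero hq hne))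
    have h1 := invPrimeSum_mul_le hq hne
    calc _ ≤ Real.exp (-(2 * K + 2 * P)) * Real.exp (2 * P - 2 * invPrimeSum (1 + P * t)) := by
          gcongr
          have := Real.add_one_le_exp (2 * P - 2 * invPrimeSum (1 + P * t))
          linarith
      _ ≤ _ := by
          rw [← Real.exp_add]
          apply Real.exp_le_exp.2
          linarith
  refine le_trans ?_ (Finset.sum_le_sum hterm)
  rw [← Finset.mul_sum, div_mul_eq_mul_div, mul_div_assoc]
  gcongr
  rw [Finset.sum_sub_distrib, ← Finset.mul_sum]
  simp only [Finset.sum_const, Finset.card_range, nsmul_eq_mul]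
  rw [div_le_iff₀ hPpos]
  have hP1 : (1 : ℝ) ≤ P := by exact_mod_cast Nat.one_le_iff_ne_zero.2 hP
  nlinarith

section Fibre

variable {k : ℕ} {p : Fin k → ℕ}

/-- The vector of the `p i`-adic valuations of `n`. -/
def valVec (p : Fin k → ℕ) (n : ℕ) : Fin k → ℕ := fun i => n.factorization (p i)

lemma factorization_prod_pow (hp : ∀ i, (p i).Prime) (hinj : Function.Injective p)
    (v : Fin k → ℕ) (j : Fin k) : (∏ i, p i ^ v i).factorization (p j) = v j := by
  rw [Nat.factorization_prod fun i _ => pow_ne_zero _ (hp i).ne_zero, Finset.sum_apply']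
  simp only [(hp _).factorization_pow, Finsupp.single_apply, hinj.eq_iff]
  simp

lemma valVec_prod_pow_mul (hp : ∀ i, (p i).Prime) (hinj : Function.Injective p)
    (v : Fin k → ℕ) (t : ℕ) : valVec p ((∏ i, p i ^ v i) * (1 + (∏ i, p i) * t)) = v := by
  ext j
  have hq : ∏ i, p i ^ v i ≠ 0 := Finset.prod_ne_zero_iff.2 fun i _ => pow_ne_zero _ (hp i).ne_zero
  rw [valVec, Nat.factorization_mul hq (by omega), Finsupp.add_apply,
    factorization_prod_pow hp hinj, Nat.factorization_eq_zero_of_not_dvd, add_zero]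
  intro h
  have h1 : p j ∣ (∏ i, p i) * t := (Finset.dvd_prod_of_mem p (Finset.mem_univ j)).mul_right t
  exact (hp j).one_lt.ne' (Nat.dvd_one.1 ((Nat.dvd_add_left h1).1 h))

lemma prod_pow_valVec_dvd (hp : ∀ i, (p i).Prime) (hinj : Function.Injective p) (n : ℕ) :
    ∏ i, p i ^ valVec p n i ∣ n := by
  refine Finset.prod_dvd_of_isRelPrime (fun i _ j _ hij => ?_) fun i _ => Nat.ordProj_dvd n (p i)
  exact Nat.coprime_iff_isRelPrime.1
    (Nat.coprime_pow_primes _ _ (hp i) (hp j) fun h => hij (hinj h))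

lemma invPrimeSum_prod_pow_le (hp : ∀ i, (p i).Prime) (v : Fin k → ℕ) :
    invPrimeSum (∏ i, p i ^ v i) ≤ k := by
  have hsub : (∏ i, p i ^ v i).primeFactors ⊆ Finset.univ.image p := by
    intro r hr
    obtain ⟨hr, hd, _⟩ := Nat.mem_primeFactors.1 hr
    obtain ⟨i, _, hi⟩ := (hr.prime.dvd_finsetProd_iff _).1 hd
    exact Finset.mem_image.2 ⟨i, Finset.mem_univ i,
      ((Nat.prime_dvd_prime_iff_eq hr (hp i)).1 (hr.dvd_of_dvd_pow hi)).symm⟩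
  calc invPrimeSum (∏ i, p i ^ v i) ≤ ∑ r ∈ Finset.univ.image p, (1 : ℝ) := by
        refine (Finset.sum_le_sum_of_subset_of_nonneg hsub fun _ _ _ => by positivity).trans ?_
        exact Finset.sum_le_sum fun r _ => Nat.cast_inv_le_one r
    _ ≤ k := by
        have := Finset.card_image_le (s := Finset.univ) (f := p)
        simp only [Finset.card_univ, Fintype.card_fin] at this
        simpa using this

/-- The lower bound for the average of `φ(n) / n` over the integers with prescribed valuations at
the primes `p i`. -/
noncomputable def totientRatio (p : Fin k → ℕ) : ℝ :=
  Real.exp (-(2 * k + 2 * (∏ i, p i : ℕ))) / (∏ i, p i : ℕ)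

lemma totientRatio_pos (hp : ∀ i, (p i).Prime) : 0 < totientRatio p := by
  have : 0 < ∏ i, p i := Finset.prod_pos fun i _ => (hp i).pos
  unfold totientRatio
  positivity

lemma totientRatio_mul_card_le (hp : ∀ i, (p i).Prime) (hinj : Function.Injective p)
    (v : Fin k → ℕ) (N : ℕ) :
    totientRatio p * ({n ∈ Finset.Ioc 0 N | valVec p n = v}.card : ℝ) ≤
      ∑ n ∈ Finset.Ioc 0 N with valVec p n = v, (n.totient : ℝ) / n := by
  set q := ∏ i, p i ^ v i with hq
  set P := ∏ i, p i with hP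
  have hq0 : q ≠ 0 := Finset.prod_ne_zero_iff.2 fun i _ => pow_ne_zero _ (hp i).ne_zero
  have hP0 : P ≠ 0 := Finset.prod_ne_zero_iff.2 fun i _ => (hp i).ne_zero
  have hcard : ({n ∈ Finset.Ioc 0 N | valVec p n = v}.card : ℝ) ≤ (N / q : ℕ) := by
    rw [← Nat.Ioc_filter_dvd_card_eq_div]
    gcongr with n hn
    intro h
    rw [hq, ← h]
    exact prod_pow_valVec_dvd hp hinj n
  refine (mul_le_mul_of_nonneg_left hcard (totientRatio_pos hp).le).trans ?_
  rcases Nat.eq_zero_or_pos (N / q) with h0 | h0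
  · rw [h0, Nat.cast_zero, mul_zero]
    exact Finset.sum_nonneg fun _ _ => by positivity
  refine (le_sum_totient_div_progression hq0 hP0 h0.ne'
    (invPrimeSum_prod_pow_le hp v)).trans ?_
  have hinj' : Set.InjOn (fun t => q * (1 + P * t))
      (Finset.range ((N / q - 1) / P + 1) : Set ℕ) := by
    intro a _ b _ hab
    have h1 := Nat.eq_of_mul_eq_mul_left (Nat.pos_of_ne_zero hq0) hab
    exact Nat.eq_of_mul_eq_mul_left (Nat.pos_of_ne_zero hP0) (Nat.add_left_cancel h1)
  rw [← Finset.sum_image (f := fun n : ℕ => (n.totient : ℝ) / n) hinj']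
  refine Finset.sum_le_sum_of_subset_of_nonneg (fun n hn => ?_) fun _ _ _ => by positivity
  obtain ⟨t, ht, rfl⟩ := Finset.mem_image.1 hn
  have ht' : t ≤ (N / q - 1) / P := by have := Finset.mem_range.1 ht; omega
  have h1 := (Nat.mul_le_mul_left P ht').trans (Nat.mul_div_le (N / q - 1) P)
  have h2 : 1 + P * t ≤ N / q := by omega
  simp only [Finset.mem_filter, Finset.mem_Ioc]
  refine ⟨⟨by positivity, ?_⟩, valVec_prod_pow_mul hp hinj v t⟩
  exact (Nat.mul_le_mul_left q h2).trans (Nat.mul_div_le N q)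

end Fibre

/-- Abel summation: nonnegative partial sums stay nonnegative under weighting by a nonnegative
decreasing sequence. -/
lemma sum_mul_antitone_nonneg {a g : ℕ → ℝ} (hg : Antitone g) (hg0 : ∀ n, 0 ≤ g n)
    (ha : ∀ N, 0 ≤ ∑ n ∈ Finset.range N, a n) (N : ℕ) :
    0 ≤ ∑ n ∈ Finset.range N, a n * g n := by
  have key : ∀ N, g N * ∑ n ∈ Finset.range (N + 1), a n ≤
      ∑ n ∈ Finset.range (N + 1), a n * g n := by
    intro N
    induction N with
    | zero => simp [mul_comm]
    | succ N ih =>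
      rw [Finset.sum_range_succ, Finset.sum_range_succ (n := N + 1), mul_add]
      have := mul_le_mul_of_nonneg_right (hg N.le_succ) (ha (N + 1))
      linarith [mul_comm (g (N + 1)) (a (N + 1))]
  cases N with
  | zero => simp
  | succ N => exact (mul_nonneg (hg0 N) (ha (N + 1))).trans (key N)

/-- Partial sums of `φ(n) / n * W(n)` dominate those of `W(n)`, if `W` is the product of a
decreasing function and a function of the valuations at the primes `p i`. -/
lemma totientRatio_mul_sum_le {k : ℕ} {p : Fin k → ℕ} (hp : ∀ i, (p i).Prime)
    (hinj : Function.Injective p) {g : ℕ → ℝ} (hg : Antitone g) (hg0 : ∀ n, 0 ≤ g n)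
    {u : (Fin k → ℕ) → ℝ} (hu : ∀ v, 0 ≤ u v) (N : ℕ) :
    totientRatio p * ∑ n ∈ Finset.range N, g n * u (valVec p (n + 1)) ≤
      ∑ n ∈ Finset.range N,
        ((n + 1).totient : ℝ) / (n + 1 : ℕ) * (g n * u (valVec p (n + 1))) := by
  rw [← sub_nonneg, Finset.mul_sum, ← Finset.sum_sub_distrib,
    ← Finset.sum_fiberwise_of_maps_to (t := (Finset.range N).image fun n => valVec p (n + 1))
      fun n hn => Finset.mem_image_of_mem _ hn]
  refine Finset.sum_nonneg fun v _ => ?_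
  have h := sum_mul_antitone_nonneg (a := fun n => if valVec p (n + 1) = v then
    ((n + 1).totient : ℝ) / (n + 1 : ℕ) - totientRatio p else 0) hg hg0 (fun M => ?_) N
  · rw [Finset.sum_filter]
    refine (mul_nonneg (hu v) h).trans_eq ?_
    rw [Finset.mul_sum]
    refine Finset.sum_congr rfl fun n _ => ?_
    split_ifs with hv
    · rw [hv]
      ring
    · ring
  · have h1 := totientRatio_mul_card_le hp hinj v M
    rw [Finset.card_eq_sum_ones, Nat.cast_sum, Finset.mul_sum, ← sub_nonneg,
      ← Finset.sum_sub_distrib, Finset.sum_filter] at h1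
    have h2 : Finset.Ioc 0 M = (Finset.range M).image (· + 1) := by
      ext n
      simp only [Finset.mem_Ioc, Finset.mem_image, Finset.mem_range]
      exact ⟨fun h => ⟨n - 1, by omega, by omega⟩, by rintro ⟨a, ha, rfl⟩; omega⟩
    rw [h2, Finset.sum_image fun a _ b _ h => by simpa using h] at h1
    simpa using h1

/-! ### Neighbourhoods of the reduced fractions on the circle -/

lemma volume_real_ball_le {x : UnitAddCircle} {ε : ℝ} (hε : 0 ≤ ε) :
    volume.real (Metric.ball x ε) ≤ 2 * ε := by
  rw [measureReal_def, ← measure_congr AddCircle.closedBall_ae_eq_ball,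
    AddCircle.volume_closedBall, ENNReal.toReal_ofReal (by positivity)]
  exact min_le_right _ _

lemma volume_real_ball {x : UnitAddCircle} {ε : ℝ} (hε : 0 ≤ ε) (hε' : 2 * ε ≤ 1) :
    volume.real (Metric.ball x ε) = 2 * ε := by
  rw [measureReal_def, ← measure_congr AddCircle.closedBall_ae_eq_ball,
    AddCircle.volume_closedBall, ENNReal.toReal_ofReal (by positivity), min_eq_right hε']

/-- The numerators of the reduced fractions with denominator `n`. -/
def reducedNumerators (n : ℕ) : Finset ℕ := {a ∈ Finset.range n | a.gcd n = 1}

lemma card_reducedNumerators (n : ℕ) : (reducedNumerators n).card = n.totient := by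
  rw [Nat.totient_eq_card_coprime, reducedNumerators]
  congr 1
  ext a
  simp only [Finset.mem_filter, Nat.Coprime, Nat.gcd_comm]

lemma approxAddOrderOf_eq_biUnion {n : ℕ} (hn : 0 < n) (δ : ℝ) :
    approxAddOrderOf UnitAddCircle n δ =
      ⋃ a ∈ reducedNumerators n, Metric.ball (((a : ℝ) / n : ℝ) : UnitAddCircle) δ := by
  ext x
  rw [UnitAddCircle.mem_approxAddOrderOf_iff hn]
  simp [reducedNumerators, gcd_eq_nat_gcd, dist_eq_norm, and_assoc]

/-- A difference of fractions has circle norm `|r| / (m n)`, for an integer `r` congruent to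
`a n - b m` modulo `m n`. -/
lemma exists_norm_sub_fraction {m n : ℕ} (hm : 0 < m) (hn : 0 < n) (a b : ℕ) :
    ∃ k : ℤ, ‖(((a : ℝ) / m : ℝ) : UnitAddCircle) - (((b : ℝ) / n : ℝ) : UnitAddCircle)‖ =
      |(((a * n - b * m - k * (m * n) : ℤ)) : ℝ)| / (m * n) := by
  refine ⟨round ((a : ℝ) / m - b / n), ?_⟩
  have hm' : (0 : ℝ) < m := by exact_mod_cast hm
  have hn' : (0 : ℝ) < n := by exact_mod_cast hn
  have h : (((a * n - b * m - round ((a : ℝ) / m - b / n) * (m * n) : ℤ)) : ℝ) =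
      ((a : ℝ) / m - b / n - round ((a : ℝ) / m - b / n)) * (m * n) := by
    push_cast
    field_simp
  rw [h, abs_mul, abs_of_pos (show (0 : ℝ) < m * n by positivity),
    mul_div_cancel_right₀ _ (by positivity), ← AddCircle.coe_sub, UnitAddCircle.norm_eq]

/-- Distinct reduced fractions do not differ by an integer. -/
lemma eq_of_mul_sub_mul_eq {m n a b : ℕ} (ha : a ∈ reducedNumerators m)
    (hb : b ∈ reducedNumerators n) {k : ℤ} (h : (a * n - b * m - k * (m * n) : ℤ) = 0) :
    m = n ∧ a = b := by
  simp only [reducedNumerators, Finset.mem_filter, Finset.mem_range] at ha hb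
  have h1 : (m : ℤ) ∣ a * n := ⟨b + k * n, by linarith⟩
  have h2 : (n : ℤ) ∣ b * m := ⟨a - k * m, by linarith⟩
  have h1' : m ∣ n := (Nat.Coprime.symm ha.2).dvd_of_dvd_mul_left (by exact_mod_cast h1)
  have h2' : n ∣ m := (Nat.Coprime.symm hb.2).dvd_of_dvd_mul_left (by exact_mod_cast h2)
  have hmn : m = n := Nat.dvd_antisymm h1' h2'
  subst hmn
  refine ⟨rfl, ?_⟩
  have hm0 : (m : ℤ) ≠ 0 := by exact_mod_cast (by omega : m ≠ 0)
  have h3 : (a : ℤ) - b = m * k := by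
    apply mul_right_cancel₀ hm0
    linarith
  have h4 : a % m = b % m := (Nat.modEq_iff_dvd.2 ⟨-k, by linarith⟩ : a ≡ b [MOD m])
  rwa [Nat.mod_eq_of_lt ha.1, Nat.mod_eq_of_lt hb.1] at h4

lemma volume_real_approxAddOrderOf {n : ℕ} (hn : 0 < n) {δ : ℝ} (hδ : 0 ≤ δ)
    (hδn : 2 * δ * n ≤ 1) :
    volume.real (approxAddOrderOf UnitAddCircle n δ) = 2 * δ * n.totient := by
  have hn' : (1 : ℝ) ≤ n := by exact_mod_cast hn
  rw [approxAddOrderOf_eq_biUnion hn, measureReal_biUnion_finset]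
  · rw [Finset.sum_congr rfl fun a _ => volume_real_ball hδ (by nlinarith), Finset.sum_const,
      card_reducedNumerators, nsmul_eq_mul, mul_comm]
  · intro a ha b hb hab
    apply Metric.ball_disjoint_ball
    rw [dist_eq_norm]
    obtain ⟨k, hk⟩ := exists_norm_sub_fraction hn hn a b
    rw [hk, le_div_iff₀ (by positivity)]
    set r : ℤ := a * n - b * n - k * (n * n) with hr
    have hr0 : r ≠ 0 := fun h => hab (eq_of_mul_sub_mul_eq ha hb h).2
    have hdvd : (n : ℤ) ∣ r := ⟨a - b - k * n, by rw [hr]; ring⟩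
    have h1 : (n : ℤ) ≤ |r| := Int.le_of_dvd (abs_pos.2 hr0) ((dvd_abs _ _).2 hdvd)
    have h2 : (n : ℝ) ≤ |(r : ℝ)| := by exact_mod_cast h1
    nlinarith
  · exact fun _ _ => measurableSet_ball

/-- Nearby pairs of reduced fractions with distinct denominators. Their difference is a nonzero
multiple of `gcd m n / (m n)`, and at most `gcd m n` pairs share one difference modulo `1`, so that
the greatest common divisor cancels from the count. -/
lemma card_close_fractions_le {m n : ℕ} (hm : 0 < m) (hn : 0 < n) (hmn : m ≠ n) {δ : ℝ}
    (hδ : 0 ≤ δ) :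
    (({ab ∈ reducedNumerators m ×ˢ reducedNumerators n |
      ‖(((ab.1 : ℝ) / m : ℝ) : UnitAddCircle) - (((ab.2 : ℝ) / n : ℝ) : UnitAddCircle)‖ <
        2 * δ}.card : ℕ) : ℝ) ≤ 4 * δ * m * n := by
  classical
  choose k hk using exists_norm_sub_fraction hm hn
  set d := m.gcd n with hd
  have hd0 : 0 < d := Nat.gcd_pos_of_pos_left n hm
  obtain ⟨m', hm'⟩ : d ∣ m := Nat.gcd_dvd_left m n
  obtain ⟨n', hn'⟩ : d ∣ n := Nat.gcd_dvd_right m n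
  have hm'0 : 0 < m' := Nat.pos_of_ne_zero (by rintro rfl; simp at hm'; omega)
  have hn'0 : 0 < n' := Nat.pos_of_ne_zero (by rintro rfl; simp at hn'; omega)
  have hcop : Nat.Coprime m' n' := by
    have h := Nat.gcd_mul_left d m' n'
    rw [← hm', ← hn', ← hd] at h
    exact Nat.eq_of_mul_eq_mul_left hd0 (by rw [mul_one]; exact h.symm)
  set J : ℕ := ⌊2 * δ * m * n / d⌋₊ with hJ
  set r : ℕ × ℕ → ℤ := fun ab => ab.1 * n' - ab.2 * m' - k ab.1 ab.2 * (m' * n) with hr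
  have hrd : ∀ ab : ℕ × ℕ, (ab.1 * n - ab.2 * m - k ab.1 ab.2 * (m * n) : ℤ) = d * r ab := by
    intro ab
    have h1 : (m : ℤ) = d * m' := by exact_mod_cast hm'
    have h2 : (n : ℤ) = d * n' := by exact_mod_cast hn'
    rw [hr]
    simp only
    linear_combination (ab.1 : ℤ) * h2 - (ab.2 : ℤ) * h1 - k ab.1 ab.2 * n * h1
  have hle : ({ab ∈ reducedNumerators m ×ˢ reducedNumerators n |
      ‖(((ab.1 : ℝ) / m : ℝ) : UnitAddCircle) - (((ab.2 : ℝ) / n : ℝ) : UnitAddCircle)‖ <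
        2 * δ}).card ≤ (((Finset.Icc (-(J : ℤ)) J).erase 0) ×ˢ Finset.range d).card := by
    refine Finset.card_le_card_of_injOn (fun ab => (r ab, ab.1 / m')) ?_ ?_
    · rintro ⟨a, b⟩ hab
      simp only [Finset.coe_filter, Finset.mem_product, Set.mem_ofPred_eq] at hab
      obtain ⟨⟨ha, hb⟩, hlt⟩ := hab
      have har : a < m := Finset.mem_range.1 (Finset.mem_filter.1 ha).1
      have hr0 : r (a, b) ≠ 0 := by
        intro h0
        have h := hrd (a, b)
        rw [h0, mul_zero] at h
        exact hmn (eq_of_mul_sub_mul_eq ha hb h).1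
      rw [hk, hrd (a, b), div_lt_iff₀ (by positivity)] at hlt
      push_cast at hlt
      rw [abs_mul, Nat.abs_cast] at hlt
      have hd' : (0 : ℝ) < d := by exact_mod_cast hd0
      have hJr : ((r (a, b)).natAbs : ℝ) ≤ 2 * δ * m * n / d := by
        rw [Nat.cast_natAbs, le_div_iff₀ hd']
        push_cast
        linarith
      have hJr' : (r (a, b)).natAbs ≤ J := Nat.le_floor hJr
      have hdiv : a / m' < d := (Nat.div_lt_iff_lt_mul hm'0).2 (by omega)
      simp only [Finset.coe_product, Set.mem_prod, Finset.mem_coe, Finset.mem_erase,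
        Finset.mem_Icc, Finset.mem_range]
      exact ⟨⟨hr0, by omega, by omega⟩, hdiv⟩
    · rintro ⟨a, b⟩ hab ⟨a', b'⟩ hab' heq
      simp only [Finset.coe_filter, Finset.mem_product, Set.mem_ofPred_eq] at hab hab'
      have hbr : b < n := Finset.mem_range.1 (Finset.mem_filter.1 hab.1.2).1
      have hbr' : b' < n := Finset.mem_range.1 (Finset.mem_filter.1 hab'.1.2).1
      simp only [hr, Prod.mk.injEq] at heq
      obtain ⟨h1, h2⟩ := heq
      have hn2 : (n : ℤ) = d * n' := by exact_mod_cast hn'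
      -- Modulo `m'` the residue determines `a`; the quotient then pins `a` down exactly.
      have haa : a = a' := by
        have h3 : (m' : ℤ) ∣ (a' - a) * n' :=
          ⟨(b' - b) + (k a' b' - k a b) * n, by linarith⟩
        have h4 : (m' : ℤ) ∣ a' - a :=
          (Nat.isCoprime_iff_coprime.2 hcop).dvd_of_dvd_mul_right h3
        have h5 : a % m' = a' % m' := (Nat.modEq_iff_dvd.2 h4 : a ≡ a' [MOD m'])
        rw [← Nat.div_add_mod a m', ← Nat.div_add_mod a' m', h2, h5]
      subst haa
      have hbb : b = b' := by
        have hm'z : (m' : ℤ) ≠ 0 := by exact_mod_cast hm'0.ne'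
        have h6 : (b' : ℤ) - b = n * (k a b - k a b') := by
          apply mul_left_cancel₀ hm'z
          linarith
        have h7 : b % n = b' % n := (Nat.modEq_iff_dvd.2 ⟨_, h6⟩ : b ≡ b' [MOD n])
        rwa [Nat.mod_eq_of_lt hbr, Nat.mod_eq_of_lt hbr'] at h7
      rw [hbb]
  have hcard : (((Finset.Icc (-(J : ℤ)) J).erase 0) ×ˢ Finset.range d).card = 2 * J * d := by
    rw [Finset.card_product, Finset.card_range, Finset.card_erase_of_mem (by simp),
      Int.card_Icc]
    congr 1
    omega
  have hJle : (J : ℝ) ≤ 2 * δ * m * n / d := Nat.floor_le (by positivity)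
  have hd' : (0 : ℝ) < d := by exact_mod_cast hd0
  rw [le_div_iff₀ hd'] at hJle
  calc _ ≤ ((2 * J * d : ℕ) : ℝ) := by exact_mod_cast hle.trans hcard.le
    _ = 2 * (J * d : ℝ) := by push_cast; ring
    _ ≤ 4 * δ * m * n := by linarith

/-- Quasi-independence of the neighbourhoods of the reduced fractions with distinct denominators. -/
lemma volume_real_inter_approxAddOrderOf_le {m n : ℕ} (hm : 0 < m) (hn : 0 < n) (hmn : m ≠ n)
    {δ η : ℝ} (hδ : 0 ≤ δ) (hη : 0 ≤ η) :
    volume.real (approxAddOrderOf UnitAddCircle m δ ∩ approxAddOrderOf UnitAddCircle n η) ≤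
      8 * (m * δ) * (n * η) := by
  classical
  set S := {ab ∈ reducedNumerators m ×ˢ reducedNumerators n |
      ‖(((ab.1 : ℝ) / m : ℝ) : UnitAddCircle) - (((ab.2 : ℝ) / n : ℝ) : UnitAddCircle)‖ <
        2 * max δ η} with hS
  have hsub : approxAddOrderOf UnitAddCircle m δ ∩ approxAddOrderOf UnitAddCircle n η ⊆
      ⋃ ab ∈ S, Metric.ball (((ab.1 : ℝ) / m : ℝ) : UnitAddCircle) δ ∩
        Metric.ball (((ab.2 : ℝ) / n : ℝ) : UnitAddCircle) η := by
    rw [approxAddOrderOf_eq_biUnion hm, approxAddOrderOf_eq_biUnion hn]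
    rintro x ⟨hx, hy⟩
    simp only [Set.mem_iUnion, exists_prop] at hx hy ⊢
    obtain ⟨a, ha, hxa⟩ := hx
    obtain ⟨b, hb, hxb⟩ := hy
    refine ⟨(a, b), ?_, hxa, hxb⟩
    simp only [hS, Finset.mem_filter, Finset.mem_product]
    refine ⟨⟨ha, hb⟩, ?_⟩
    rw [← dist_eq_norm]
    have h1 := dist_triangle_left (((a : ℝ) / m : ℝ) : UnitAddCircle)
      (((b : ℝ) / n : ℝ) : UnitAddCircle) x
    have h2 := Metric.mem_ball.1 hxa
    have h3 := Metric.mem_ball.1 hxb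
    linarith [le_max_left δ η, le_max_right δ η]
  have hpair : ∀ ab ∈ S, volume.real (Metric.ball (((ab.1 : ℝ) / m : ℝ) : UnitAddCircle) δ ∩
        Metric.ball (((ab.2 : ℝ) / n : ℝ) : UnitAddCircle) η) ≤ 2 * min δ η := by
    intro ab _
    rcases min_cases δ η with ⟨h, _⟩ | ⟨h, _⟩ <;> rw [h]
    · exact (measureReal_mono Set.inter_subset_left).trans (volume_real_ball_le hδ)
    · exact (measureReal_mono Set.inter_subset_right).trans (volume_real_ball_le hη)
  calc _ ≤ _ := measureReal_mono hsub (measure_ne_top _ _)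
    _ ≤ _ := measureReal_biUnion_finset_le _ _
    _ ≤ _ := Finset.sum_le_sum hpair
    _ = (S.card : ℝ) * (2 * min δ η) := by rw [Finset.sum_const, nsmul_eq_mul]
    _ ≤ (4 * max δ η * m * n) * (2 * min δ η) := by
        gcongr
        exact card_close_fractions_le hm hn hmn (hδ.trans (le_max_left _ _))
    _ = 8 * m * n * (min δ η * max δ η) := by ring
    _ = _ := by rw [min_mul_max]; ring

/-! ### The second moment method -/

/-- The Chung–Erdős inequality. -/
lemma sq_sum_measureReal_le {Ω ι : Type*} [MeasurableSpace Ω] {μ : Measure Ω} [IsFiniteMeasure μ]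
    {E : ι → Set Ω} (hE : ∀ i, MeasurableSet (E i)) (T : Finset ι) :
    (∑ i ∈ T, μ.real (E i)) ^ 2 ≤
      μ.real (⋃ i ∈ T, E i) * ∑ i ∈ T, ∑ j ∈ T, μ.real (E i ∩ E j) := by
  set U := ⋃ i ∈ T, E i with hU
  have hUm : MeasurableSet U := Finset.measurableSet_biUnion T fun i _ => hE i
  have hi : ∀ {s : Set Ω}, MeasurableSet s → Integrable (s.indicator fun _ => (1 : ℝ)) μ :=
    fun hs => (integrable_const (1 : ℝ)).indicator hs
  have hI : ∀ {s : Set Ω}, MeasurableSet s → ∫ x, s.indicator (fun _ => (1 : ℝ)) x ∂μ = μ.real s :=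
    fun hs => integral_indicator_one hs
  -- The quadratic polynomial `∫ (λ 1_U - ∑ 1_{E i}) ^ 2` in `λ` is nonnegative.
  have key : ∀ l : ℝ, 0 ≤ μ.real U * (l * l) + (-2 * ∑ i ∈ T, μ.real (E i)) * l +
      ∑ i ∈ T, ∑ j ∈ T, μ.real (E i ∩ E j) := by
    intro l
    have hpt : ∀ x, (l * U.indicator (fun _ => (1 : ℝ)) x -
        ∑ i ∈ T, (E i).indicator (fun _ => (1 : ℝ)) x) ^ 2 =
        (l * l) * U.indicator (fun _ => (1 : ℝ)) x -
          (2 * l) * ∑ i ∈ T, (E i).indicator (fun _ => (1 : ℝ)) x +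
          ∑ i ∈ T, ∑ j ∈ T, (E i ∩ E j).indicator (fun _ => (1 : ℝ)) x := by
      intro x
      have h1 : ∑ i ∈ T, ∑ j ∈ T, (E i ∩ E j).indicator (fun _ => (1 : ℝ)) x =
          (∑ i ∈ T, (E i).indicator (fun _ => (1 : ℝ)) x) ^ 2 := by
        rw [sq, Finset.sum_mul_sum]
        refine Finset.sum_congr rfl fun i _ => Finset.sum_congr rfl fun j _ => ?_
        by_cases hi : x ∈ E i <;> by_cases hj : x ∈ E j <;> simp [hi, hj]
      rw [h1]
      by_cases hx : x ∈ U
      · rw [Set.indicator_of_mem hx]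
        ring
      · have h0 : ∑ i ∈ T, (E i).indicator (fun _ => (1 : ℝ)) x = 0 :=
          Finset.sum_eq_zero fun i hi => Set.indicator_of_notMem
            (fun h => hx (Set.mem_biUnion hi h)) _
        rw [h0, Set.indicator_of_notMem hx]
        ring
    have h := integral_nonneg (μ := μ) (f := fun x => (l * U.indicator (fun _ => (1 : ℝ)) x -
        ∑ i ∈ T, (E i).indicator (fun _ => (1 : ℝ)) x) ^ 2) fun x => sq_nonneg _
    simp only [hpt] at h
    have hs : Integrable (fun x => ∑ i ∈ T, (E i).indicator (fun _ => (1 : ℝ)) x) μ :=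
      integrable_finsetSum _ fun i _ => hi (hE i)
    have hss : Integrable (fun x => ∑ i ∈ T, ∑ j ∈ T,
        (E i ∩ E j).indicator (fun _ => (1 : ℝ)) x) μ :=
      integrable_finsetSum _ fun i _ => integrable_finsetSum _ fun j _ => hi ((hE i).inter (hE j))
    have hU1 : Integrable (fun x => (l * l) * U.indicator (fun _ => (1 : ℝ)) x) μ :=
      (hi hUm).const_mul _
    have hs1 : Integrable (fun x => (2 * l) * ∑ i ∈ T, (E i).indicator (fun _ => (1 : ℝ)) x) μ :=
      hs.const_mul _
    have hIs : ∫ x, ∑ i ∈ T, (E i).indicator (fun _ => (1 : ℝ)) x ∂μ = ∑ i ∈ T, μ.real (E i) := by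
      rw [integral_finsetSum _ fun i _ => hi (hE i)]
      exact Finset.sum_congr rfl fun i _ => hI (hE i)
    have hIss : ∫ x, ∑ i ∈ T, ∑ j ∈ T, (E i ∩ E j).indicator (fun _ => (1 : ℝ)) x ∂μ =
        ∑ i ∈ T, ∑ j ∈ T, μ.real (E i ∩ E j) := by
      rw [integral_finsetSum _ fun i _ => integrable_finsetSum _ fun j _ =>
        hi ((hE i).inter (hE j))]
      refine Finset.sum_congr rfl fun i _ => ?_
      rw [integral_finsetSum _ fun j _ => hi ((hE i).inter (hE j))]
      exact Finset.sum_congr rfl fun j _ => hI ((hE i).inter (hE j))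
    have hsub : Integrable (fun x => (l * l) * U.indicator (fun _ => (1 : ℝ)) x -
        (2 * l) * ∑ i ∈ T, (E i).indicator (fun _ => (1 : ℝ)) x) μ := hU1.sub hs1
    rw [integral_add hsub hss, integral_sub hU1 hs1, integral_const_mul, integral_const_mul,
      hI hUm, hIs, hIss] at h
    linarith
  have h := discrim_le_zero key
  rw [discrim] at h
  linarith

/-! ### The Duffin–Schaeffer theorem -/

open Filter Topology in
/-- The Duffin–Schaeffer theorem, for the radii `W i / (i + 1)` around the reduced fractions with
denominator `i + 1`. The second moment method shows that the limsup set has positive measure, and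
Gallagher's zero-one law then gives full measure. -/
theorem ae_mem_addWellApproximable {W : ℕ → ℝ} (hW0 : ∀ i, 0 ≤ W i)
    (hW : ∀ᶠ i in atTop, W i ≤ 1 / 2)
    (hdiv : Tendsto (fun N => ∑ i ∈ Finset.range N, W i) atTop atTop) {c : ℝ} (hc : 0 < c)
    (hφ : ∀ N, c * ∑ i ∈ Finset.range N, W i ≤
      ∑ i ∈ Finset.range N, ((i + 1).totient : ℝ) / (i + 1 : ℕ) * W i) :
    ∀ᵐ x : UnitAddCircle, x ∈ addWellApproximable UnitAddCircle fun n => W (n - 1) / n := by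
  have hδ : Tendsto (fun n : ℕ => W (n - 1) / n) atTop (𝓝 0) := by
    have hW' : ∀ᶠ n in atTop, W (n - 1) ≤ 1 / 2 := (tendsto_sub_atTop_nat 1).eventually hW
    refine squeeze_zero' (Eventually.of_forall fun n => div_nonneg (hW0 _) n.cast_nonneg)
      (hW'.mono fun n hn => ?_) (tendsto_const_div_atTop_nhds_zero_nat (1 / 2))
    gcongr
  refine (AddCircle.addWellApproximable_ae_empty_or_univ _ hδ).resolve_left fun hnull => ?_
  set E : ℕ → Set UnitAddCircle :=
    fun i => approxAddOrderOf UnitAddCircle (i + 1) (W i / (i + 1 : ℕ)) with hE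
  have hEm : ∀ i, MeasurableSet (E i) := fun i => Metric.isOpen_thickening.measurableSet
  set B : ℕ → Set UnitAddCircle := fun M => ⋃ i ∈ Set.Ici M, E i with hB
  have hBm : ∀ M, MeasurableSet (B M) := fun M =>
    MeasurableSet.biUnion (Set.to_countable _) fun i _ => hEm i
  have hBanti : Antitone B := fun M N h => Set.biUnion_subset_biUnion_left (Set.Ici_subset_Ici.2 h)
  have hmul : ∀ i : ℕ, ((i + 1 : ℕ) : ℝ) * (W i / (i + 1 : ℕ)) = W i := fun i =>
    mul_div_cancel₀ _ (by positivity)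
  obtain ⟨M₀, hM₀⟩ := eventually_atTop.1 hW
  have htail : ∀ M ≥ M₀, c ^ 2 / 10 ≤ volume.real (B M) := by
    intro M hM
    set K := ∑ i ∈ Finset.range M, ((i + 1).totient : ℝ) / (i + 1 : ℕ) * W i with hK
    set K' := ∑ i ∈ Finset.range M, W i with hK'
    have hK'0 : 0 ≤ K' := Finset.sum_nonneg fun i _ => hW0 i
    obtain ⟨N, hNM, hN⟩ := ((eventually_ge_atTop M).and
      (hdiv.eventually_ge_atTop (K' + 1 + 2 * |K| / c))).exists
    set S := ∑ i ∈ Finset.Ico M N, W i with hS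
    set A := ∑ i ∈ Finset.Ico M N, ((i + 1).totient : ℝ) / (i + 1 : ℕ) * W i with hA
    have hS' : S = ∑ i ∈ Finset.range N, W i - K' := Finset.sum_Ico_eq_sub _ hNM
    have hA' : A = ∑ i ∈ Finset.range N, ((i + 1).totient : ℝ) / (i + 1 : ℕ) * W i - K :=
      Finset.sum_Ico_eq_sub _ hNM
    have hSK : 1 + 2 * |K| / c ≤ S := by linarith
    have hS1 : 1 ≤ S := le_trans (by have : 0 ≤ 2 * |K| / c := by positivity
                                     linarith) hSK
    have hAS : c * S ≤ 2 * A := by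
      have h1 : 2 * |K| ≤ c * S := by
        have : 2 * |K| / c ≤ S := by linarith
        rw [div_le_iff₀ hc] at this
        linarith
      have h2 := hφ N
      have h3 : c * S = c * ∑ i ∈ Finset.range N, W i - c * K' := by rw [hS', mul_sub]
      have h4 : 0 ≤ c * K' := by positivity
      linarith [le_abs_self K]
    have hvol : ∀ i ∈ Finset.Ico M N,
        volume.real (E i) = 2 * (((i + 1).totient : ℝ) / (i + 1 : ℕ) * W i) := by
      intro i hi
      have hWi := hM₀ i (hM.trans (Finset.mem_Ico.1 hi).1)
      rw [hE]
      simp only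
      rw [volume_real_approxAddOrderOf i.succ_pos (div_nonneg (hW0 i) (Nat.cast_nonneg _))]
      · ring
      · have := hmul i
        linarith
    have hvol' : ∀ i ∈ Finset.Ico M N, volume.real (E i) ≤ 2 * W i := by
      intro i hi
      rw [hvol i hi]
      have h1 : ((i + 1).totient : ℝ) / (i + 1 : ℕ) ≤ 1 :=
        div_le_one_of_le₀ (by exact_mod_cast Nat.totient_le _) (Nat.cast_nonneg _)
      linarith [mul_le_of_le_one_left (hW0 i) h1]
    have hpair : ∀ i ∈ Finset.Ico M N, ∀ j ∈ Finset.Ico M N, volume.real (E i ∩ E j) ≤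
        8 * W i * W j + if i = j then 2 * W i else 0 := by
      intro i hi j _
      split_ifs with h
      · rw [← h, Set.inter_self]
        have := mul_nonneg (hW0 i) (hW0 i)
        linarith [hvol' i hi]
      · rw [add_zero]
        have := volume_real_inter_approxAddOrderOf_le i.succ_pos j.succ_pos (by omega)
          (div_nonneg (hW0 i) (Nat.cast_nonneg (i + 1)))
          (div_nonneg (hW0 j) (Nat.cast_nonneg (j + 1)))
        rwa [hmul, hmul] at this
    have hdouble : ∑ i ∈ Finset.Ico M N, ∑ j ∈ Finset.Ico M N, volume.real (E i ∩ E j) ≤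
        10 * S ^ 2 := by
      refine (Finset.sum_le_sum fun i hi => Finset.sum_le_sum fun j hj =>
        hpair i hi j hj).trans ?_
      have h1 : ∑ i ∈ Finset.Ico M N, ∑ j ∈ Finset.Ico M N,
          (8 * W i * W j + if i = j then 2 * W i else 0) = 8 * S * S + 2 * S := by
        rw [mul_assoc, hS, Finset.sum_mul_sum, Finset.mul_sum, Finset.mul_sum,
          ← Finset.sum_add_distrib]
        refine Finset.sum_congr rfl fun i hi => ?_
        rw [Finset.sum_add_distrib, Finset.sum_ite_eq, if_pos hi, Finset.mul_sum]
        simp only [mul_assoc]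
      rw [h1]
      nlinarith
    have hCE := sq_sum_measureReal_le (μ := volume) hEm (Finset.Ico M N)
    rw [Finset.sum_congr rfl hvol, ← Finset.mul_sum] at hCE
    have hUB : volume.real (⋃ i ∈ Finset.Ico M N, E i) ≤ volume.real (B M) :=
      measureReal_mono (Set.biUnion_subset_biUnion_left fun i hi => (Finset.mem_Ico.1 hi).1)
        (measure_ne_top _ _)
    have h1 : (c * S) ^ 2 ≤ volume.real (B M) * (10 * S ^ 2) :=
      (pow_le_pow_left₀ (by positivity) hAS 2).trans <| hCE.trans <|
        mul_le_mul hUB hdouble (Finset.sum_nonneg fun _ _ => Finset.sum_nonneg fun _ _ =>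
          measureReal_nonneg) measureReal_nonneg
    have hS2 : 0 < S ^ 2 := by positivity
    rw [div_le_iff₀ (by norm_num)]
    refine le_of_mul_le_mul_right ?_ hS2
    linarith
  have hlim := tendsto_measure_iInter_atTop (μ := (volume : Measure UnitAddCircle))
    (fun M => (hBm M).nullMeasurableSet) hBanti ⟨0, measure_ne_top _ _⟩
  have hpos : ENNReal.ofReal (c ^ 2 / 10) ≤ volume (⋂ M, B M) := by
    refine ge_of_tendsto hlim (eventually_atTop.2 ⟨M₀, fun M hM => ?_⟩)
    exact (ENNReal.ofReal_le_iff_le_toReal (measure_ne_top _ _)).2 (htail M hM)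
  have hsub : ⋂ M, B M ⊆
      {x | ¬ x ∉ addWellApproximable UnitAddCircle fun n => W (n - 1) / n} := by
    intro x hx
    refine not_not.2 ((UnitAddCircle.mem_addWellApproximable_iff _ x).2 ?_)
    refine Set.infinite_of_forall_exists_gt fun M => ?_
    obtain ⟨i, hi, hxi⟩ := Set.mem_iUnion₂.1 (Set.mem_iInter.1 hx M)
    refine ⟨i + 1, ?_, Nat.lt_succ_of_le hi⟩
    exact (UnitAddCircle.mem_approxAddOrderOf_iff i.succ_pos).1 hxi
  have hzero : volume (⋂ M, B M) = 0 := measure_mono_null hsub (ae_iff.1 hnull)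
  rw [hzero] at hpos
  exact absurd hpos (not_le.2 (ENNReal.ofReal_pos.2 (by positivity)))

/-! ### From the circle to the real line -/

lemma ae_real_of_ae_unitAddCircle {q : UnitAddCircle → Prop} (h : ∀ᵐ x, q x) :
    ∀ᵐ α : ℝ, q (α : UnitAddCircle) := by
  rw [← Measure.restrict_univ (μ := (volume : Measure ℝ)), ← iUnion_Ioc_intCast ℝ,
    ae_restrict_iUnion_iff]
  exact fun n => (UnitAddCircle.measurePreserving_mk n).quasiMeasurePreserving.ae h

lemma distNearestInt_mul (n : ℕ) (α : ℝ) :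
    distNearestInt (n * α) = ‖n • (α : UnitAddCircle)‖ := by
  rw [← AddCircle.coe_nsmul, UnitAddCircle.norm_eq, nsmul_eq_mul, distNearestInt]

lemma volume_norm_nsmul_le {n : ℕ} (hn : 0 < n) (ε : ℝ) :
    volume {x : UnitAddCircle | ‖n • x‖ ≤ ε} ≤ ENNReal.ofReal (2 * ε) := by
  have hmp : MeasurePreserving fun y : UnitAddCircle => n • y := by
    rcases Nat.eq_or_lt_of_le hn with h | h
    · have hid : (fun y : UnitAddCircle => n • y) = id := by
        ext y
        simp [← h]
      rw [hid]
      exact MeasurePreserving.id _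
    · exact (AddCircle.ergodic_nsmul h).toMeasurePreserving
  have hset : {x : UnitAddCircle | ‖n • x‖ ≤ ε} =
      (fun y : UnitAddCircle => n • y) ⁻¹' Metric.closedBall 0 ε := by
    ext x
    simp
  rw [hset, hmp.measure_preimage measurableSet_closedBall.nullMeasurableSet,
    AddCircle.volume_closedBall]
  exact ENNReal.ofReal_le_ofReal (min_le_right _ _)

/-- Each point near a reduced fraction with denominator `n` is close to `0` after multiplication
by `n`. -/
lemma infinite_norm_nsmul_le_of_mem {W : ℕ → ℝ} {x : UnitAddCircle}
    (hx : x ∈ addWellApproximable UnitAddCircle fun n => W (n - 1) / n) :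
    {i : ℕ | ‖(i + 1) • x‖ ≤ W i}.Infinite := by
  rw [UnitAddCircle.mem_addWellApproximable_iff] at hx
  refine Set.infinite_of_forall_exists_gt fun M => ?_
  obtain ⟨n, ⟨a, han, -, hlt⟩, hn⟩ := hx.exists_gt (M + 1)
  obtain ⟨i, rfl⟩ : ∃ i, n = i + 1 := ⟨n - 1, by omega⟩
  refine ⟨i, ?_, by omega⟩
  have hpos : (0 : ℝ) < (i + 1 : ℕ) := by positivity
  have h0 : (i + 1) • (((a : ℝ) / (i + 1 : ℕ) : ℝ) : UnitAddCircle) = 0 := by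
    rw [← AddCircle.coe_nsmul, nsmul_eq_mul, mul_div_cancel₀ _ hpos.ne']
    exact (AddCircle.coe_eq_zero_iff 1).2 ⟨a, by simp⟩
  calc ‖(i + 1) • x‖ = ‖(i + 1) • (x - (((a : ℝ) / (i + 1 : ℕ) : ℝ) : UnitAddCircle))‖ := by
        rw [nsmul_sub, h0, sub_zero]
    _ ≤ (i + 1 : ℕ) * ‖x - (((a : ℝ) / (i + 1 : ℕ) : ℝ) : UnitAddCircle)‖ := norm_nsmul_le
    _ ≤ (i + 1 : ℕ) * (W i / (i + 1 : ℕ)) := by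
        gcongr
        exact hlt.le
    _ = W i := mul_div_cancel₀ _ hpos.ne'

/-! ### The weights -/

section Weight

variable {k : ℕ} {p : Fin k → ℕ} {f : Fin k → ℝ → ℝ}

/-- The product of the values `f i (p i ^ (-v i))`, the weight of the integers with valuations
`v`. -/
noncomputable def valWeight (p : Fin k → ℕ) (f : Fin k → ℝ → ℝ) (v : Fin k → ℕ) : ℝ :=
  ∏ i, f i ((p i : ℝ) ^ (-(v i : ℤ)))

lemma padicWeight_eq_valWeight (hp : ∀ i, (p i).Prime) (n : ℕ+) :
    padicWeight p f n = valWeight p f (valVec p n) := by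
  refine Finset.prod_congr rfl fun i _ => ?_
  have : ((n : ℕ) : ℚ) ≠ 0 := by exact_mod_cast n.ne_zero
  rw [padicNorm.eq_zpow_of_nonzero this, padicValRat.of_nat, valVec,
    Nat.factorization_def _ (hp i)]
  push_cast
  rfl

lemma valWeight_pos (hp : ∀ i, (p i).Prime) (hf : ∀ i, ∀ x : ℝ, 0 < x → 0 < f i x)
    (v : Fin k → ℕ) : 0 < valWeight p f v :=
  Finset.prod_pos fun i _ => hf i _ (zpow_pos (by exact_mod_cast (hp i).pos) _)

lemma padicWeight_pos (hp : ∀ i, (p i).Prime) (hf : ∀ i, ∀ x : ℝ, 0 < x → 0 < f i x) (n : ℕ+) :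
    0 < padicWeight p f n := by
  rw [padicWeight_eq_valWeight hp]
  exact valWeight_pos hp hf _

end Weight

theorem theorem2 (k : ℕ) (p : Fin k → ℕ) (hp : ∀ i, (p i).Prime)
    (hp_distinct : Function.Injective p)
    (f : Fin k → ℝ → ℝ) (hf : ∀ i, ∀ x : ℝ, 0 < x → 0 < f i x)
    (ψ : ℕ+ → ℝ) (hψ_nonneg : ∀ n, 0 ≤ ψ n) (hψ_anti : Antitone ψ) :
    ((¬ Summable fun n : ℕ+ => ψ n / padicWeight p f n) →
      ∀ᵐ α : ℝ ∂volume,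
        {n : ℕ+ | padicWeight p f n * distNearestInt ((n : ℝ) * α) ≤ ψ n}.Infinite) ∧
    ((Summable fun n : ℕ+ => ψ n / padicWeight p f n) →
      ∀ᵐ α : ℝ ∂volume,
        {n : ℕ+ | padicWeight p f n * distNearestInt ((n : ℝ) * α) ≤ ψ n}.Finite) := by
  have hw := padicWeight_pos hp hf
  have hV0 : ∀ n : ℕ+, 0 ≤ ψ n / padicWeight p f n := fun n => div_nonneg (hψ_nonneg n) (hw n).le
  have hiff : ∀ (α : ℝ) (n : ℕ+), padicWeight p f n * distNearestInt ((n : ℝ) * α) ≤ ψ n ↔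
      ‖(n : ℕ) • (α : UnitAddCircle)‖ ≤ ψ n / padicWeight p f n := by
    intro α n
    rw [le_div_iff₀ (hw n), ← distNearestInt_mul, mul_comm]
  simp only [hiff]
  refine ⟨fun hdiv => ?_, fun hsum => ?_⟩
  · set W : ℕ → ℝ := fun i => ψ i.succPNat / padicWeight p f i.succPNat with hW
    have hW0 : ∀ i, 0 ≤ W i := fun i => hV0 _
    have htransfer : ∀ x : UnitAddCircle, {i : ℕ | ‖(i + 1) • x‖ ≤ W i}.Infinite →
        {n : ℕ+ | ‖(n : ℕ) • x‖ ≤ ψ n / padicWeight p f n}.Infinite := fun x hx =>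
      (hx.image Nat.succPNat_injective.injOn).mono (by rintro _ ⟨i, hi, rfl⟩; exact hi)
    by_cases hsmall : ∀ᶠ i in Filter.atTop, W i ≤ 1 / 2
    · have hdivW : Filter.Tendsto (fun N => ∑ i ∈ Finset.range N, W i)
          Filter.atTop Filter.atTop := by
        rw [← not_summable_iff_tendsto_nat_atTop_of_nonneg hW0]
        refine fun h => hdiv ?_
        exact (Equiv.pnatEquivNat.symm.summable_iff
          (f := fun n : ℕ+ => ψ n / padicWeight p f n)).1 h
      have hWeq : ∀ i, W i = ψ i.succPNat * (valWeight p f (valVec p (i + 1)))⁻¹ := fun i => by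
        rw [hW]
        simp only
        rw [padicWeight_eq_valWeight hp, div_eq_mul_inv, Nat.succPNat_coe]
      have hφ := totientRatio_mul_sum_le hp hp_distinct (g := fun i => ψ i.succPNat)
        (fun i j h => hψ_anti (Nat.succPNat_le_succPNat.2 h)) (fun i => hψ_nonneg _)
        (u := fun v => (valWeight p f v)⁻¹) fun v => (inv_pos.2 (valWeight_pos hp hf v)).le
      simp only [← hWeq] at hφ
      filter_upwards [ae_real_of_ae_unitAddCircle
        (ae_mem_addWellApproximable hW0 hsmall hdivW (totientRatio_pos hp) hφ)] with α hα
      exact htransfer α (infinite_norm_nsmul_le_of_mem hα)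
    · -- The distance to the nearest integer never exceeds `1 / 2`.
      refine Filter.Eventually.of_forall fun α => htransfer α ?_
      refine Set.infinite_of_forall_exists_gt fun M => ?_
      obtain ⟨i, hi, hWi⟩ := Filter.frequently_atTop.1 (Filter.not_eventually.1 hsmall) (M + 1)
      refine ⟨i, ?_, hi⟩
      have := AddCircle.norm_le_half_period (1 : ℝ) (x := (i + 1) • (α : UnitAddCircle)) one_ne_zero
      rw [abs_one] at this
      exact this.trans (not_le.1 hWi).le
  · refine ae_real_of_ae_unitAddCircle
      (q := fun x => {n : ℕ+ | ‖(n : ℕ) • x‖ ≤ ψ n / padicWeight p f n}.Finite)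
      (ae_finite_setOfPred_mem (s := fun n : ℕ+ =>
        {x : UnitAddCircle | ‖(n : ℕ) • x‖ ≤ ψ n / padicWeight p f n}) ?_)
    refine ne_top_of_le_ne_top ?_ (ENNReal.tsum_le_tsum fun n =>
      volume_norm_nsmul_le n.pos (ψ n / padicWeight p f n))
    exact (hsum.mul_left 2).tsum_ofReal_ne_top
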